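/- Fix a squarefree integer $D>1$ and a real number $\varepsilon>0$. There is a constant $C=C(D,\varepsilon)>0$, depending only on $D$ and $\varepsilon$, such that the following holds. Let $K$ be a totally real number field of degree $4$ over $\mathbb{Q}$ that contains $\sqrt{D}$, let $\Delta$ be the discriminant of $K$, and let $\mathcal{O}_K$ be its ring of integers. Then for every integer $k$ with $0<k<C\,\Delta^{1/4-\varepsilon}$ there is an element $\alpha\in\mathcal{O}_K$, positive under every embedding $K\hookrightarrow\mathbb{R}$, such that $k\alpha$ is not a sum of squares of elements of $\mathcal{O}_K$. -/

import Mathlib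

/-- The set `𝓞_K^+` of the totally positive elements of the ring of integers of a number field `K`:
the algebraic integers that are positive under every real embedding of `K`.
(For totally real `K`, these are all the embeddings of `K`.) -/
def totallyPositiveIntegers (K : Type*) [Field K] [NumberField K] :
    Set (NumberField.RingOfIntegers K) :=
  {α | ∀ σ : K →+* ℝ, 0 < σ (α : K)}

/-! Let `σ` be the nontrivial automorphism of `K` over `ℚ(√D)`. Among integers `x` moved by `σ`,
take one with `T = Tr((x - σ x)²)` least, and put `y = x - σ x`, `R = √T`. Since `σ y = -y`, the
family `1, √D, y, √D y` is independent, and its discriminant gives `|Δ| ≤ 16 D² R⁴`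
(`abs_discr_le_of_anti_invariant`). Every conjugate of `y` is at most `R` in absolute value, so `α =
y + a` is totally positive for an integer `a` just above `R`. If `kα`, which `σ` moves, is a sum of
squares, then some root `z` is moved by `σ` and `Tr(z²) ≤ Tr(kα) = 4ka`
(`IsSumSq.exists_not_fixed`). Minimality gives `R² ≤ Tr((z - σ z)²) ≤ 4 Tr(z²) ≤ 16ka`, so `k` is at
least `R / 32`, of order `|Δ|^(1/4)`. -/

open NumberField Module

/-! ### Trace form and discriminant of a totally real field -/

section TotallyReal

variable {K : Type*} [Field K] [NumberField K]

/-- The trace of a totally real number field is the sum of its real embeddings. -/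
theorem trace_eq_sum_real_embeddings [IsTotallyReal K] (z : K) :
    ((Algebra.trace ℚ K z : ℚ) : ℝ) =
      ∑ φ : K →+* ℂ, (IsTotallyReal.complexEmbedding_isReal φ).embedding z := by
  have h := trace_eq_sum_embeddings ℂ (K := ℚ) (x := z)
  apply Complex.ofReal_injective
  rw [Complex.ofReal_sum]
  simp only [ComplexEmbedding.IsReal.coe_embedding_apply]
  rw [← Fintype.sum_equiv (RingHom.equivRatAlgHom K ℂ).symm (fun φ : K →ₐ[ℚ] ℂ => φ z)
    (fun φ : K →+* ℂ => φ z) (fun φ => rfl), ← h]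
  simp

theorem trace_mul_self_nonneg [IsTotallyReal K] (z : K) : 0 ≤ Algebra.trace ℚ K (z * z) := by
  have : (0 : ℝ) ≤ (Algebra.trace ℚ K (z * z) : ℚ) := by
    rw [trace_eq_sum_real_embeddings]
    exact Finset.sum_nonneg fun φ _ => by rw [map_mul]; exact mul_self_nonneg _
  exact_mod_cast this

theorem sq_le_trace_mul_self [IsTotallyReal K] (ψ : K →+* ℝ) (z : K) :
    ψ z ^ 2 ≤ (Algebra.trace ℚ K (z * z) : ℚ) := by
  rw [trace_eq_sum_real_embeddings]
  have h := Finset.single_le_sum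
    (f := fun φ : K →+* ℂ => (IsTotallyReal.complexEmbedding_isReal φ).embedding (z * z))
    (fun φ _ => by rw [map_mul]; exact mul_self_nonneg _)
    (Finset.mem_univ (Complex.ofRealHom.comp ψ))
  refine le_trans (le_of_eq ?_) h
  apply Complex.ofReal_injective
  rw [ComplexEmbedding.IsReal.coe_embedding_apply]
  simp [sq]

theorem trace_mul_self_pos [IsTotallyReal K] {z : K} (hz : z ≠ 0) :
    0 < Algebra.trace ℚ K (z * z) := by
  obtain ⟨φ⟩ : Nonempty (K →+* ℂ) := inferInstance
  have h := sq_le_trace_mul_self (IsTotallyReal.complexEmbedding_isReal φ).embedding z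
  have h' : 0 < (IsTotallyReal.complexEmbedding_isReal φ).embedding z ^ 2 := by
    have := (map_ne_zero (IsTotallyReal.complexEmbedding_isReal φ).embedding).2 hz
    positivity
  exact_mod_cast h'.trans_le h

/-- The Cauchy-Schwarz inequality for the trace form of a totally real number field. -/
theorem trace_mul_sq_le [IsTotallyReal K] (y z : K) :
    Algebra.trace ℚ K (y * z) ^ 2 ≤ Algebra.trace ℚ K (y * y) * Algebra.trace ℚ K (z * z) := by
  have : ((Algebra.trace ℚ K (y * z) : ℚ) : ℝ) ^ 2 ≤
      (Algebra.trace ℚ K (y * y) : ℚ) * (Algebra.trace ℚ K (z * z) : ℚ) := by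
    simp only [trace_eq_sum_real_embeddings, map_mul, ← pow_two (_ : ℝ)]
    exact Finset.sum_mul_sq_le_sq_mul_sq Finset.univ
      (fun φ : K →+* ℂ => (IsTotallyReal.complexEmbedding_isReal φ).embedding y)
      (fun φ : K →+* ℂ => (IsTotallyReal.complexEmbedding_isReal φ).embedding z)
  exact_mod_cast this

/-- The discriminant of a number field is bounded by that of any linearly independent family of
algebraic integers. -/
theorem abs_discr_le_abs_discr_of_linearIndependent {n : ℕ} (hn : finrank ℚ K = n)
    (b : Fin n → 𝓞 K) (hb : LinearIndependent ℚ fun i => (b i : K)) :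
    |(discr K : ℚ)| ≤ |Algebra.discr ℚ fun i => (b i : K)| := by
  let e : Basis (Fin n) ℤ (𝓞 K) := (RingOfIntegers.basis K).reindex
    (Fintype.equivFinOfCardEq (by rw [← finrank_eq_card_chooseBasisIndex, RingOfIntegers.rank, hn]))
  -- The determinant is a nonzero integer, so its square is at least 1.
  have h1 : Algebra.discr ℤ b = (e.toMatrix b).det ^ 2 * discr K := by
    rw [← discr_eq_discr K e, ← Algebra.discr_of_matrix_vecMul, Basis.toMatrix_map_vecMul]
  have h2 : ((Algebra.discr ℤ b : ℤ) : ℚ) = Algebra.discr ℚ fun i => (b i : K) := by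
    rw [Algebra.discr_def, Algebra.discr_def, Int.cast_det]
    congr 1
    ext i j
    exact Algebra.coe_trace_int (K := K) (b i * b j)
  have h3 : (Algebra.discr ℚ fun i => (b i : K)) ≠ 0 := by
    have : Nonempty (Fin n) := ⟨⟨0, hn ▸ finrank_pos⟩⟩
    have := Algebra.discr_not_zero_of_basis ℚ
      (basisOfLinearIndependentOfCardEqFinrank hb (by simp [hn]))
    simpa using this
  have h4 : (e.toMatrix b).det ≠ 0 := by
    intro h
    rw [h] at h1
    apply h3
    rw [← h2, h1]
    simp
  rw [← h2, h1]
  push_cast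
  rw [abs_mul]
  refine le_mul_of_one_le_left (abs_nonneg _) ?_
  rw [abs_of_nonneg (sq_nonneg _)]
  have : 0 < (e.toMatrix b).det ^ 2 := by positivity
  exact_mod_cast this

end TotallyReal

/-! ### The involution over the quadratic subfield -/

section Involution

variable {K : Type*} [Field K] [NumberField K]

theorem sq_ne_intCast_of_squarefree {D : ℤ} (hD : 1 < D) (hDsq : Squarefree D) (q : ℚ) :
    q ^ 2 ≠ D := by
  intro h
  obtain ⟨m, rfl⟩ : ∃ m : ℤ, (m : ℚ) = q := by
    have : IsIntegral ℤ q := by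
      refine IsIntegral.of_pow two_pos ?_
      rw [h]
      exact isIntegral_algebraMap (x := D)
    obtain ⟨m, hm⟩ := IsIntegrallyClosed.isIntegral_iff.1 this
    exact ⟨m, by simpa using hm⟩
  have h' : m * m = D := by rw [← sq]; exact_mod_cast h
  have hu := hDsq m (by rw [h'])
  rcases Int.isUnit_iff.1 hu with rfl | rfl <;> omega

/-- A quartic field has a nontrivial automorphism over each quadratic subfield. -/
theorem exists_algEquiv_fixing_sqrt (hK : finrank ℚ K = 4) {D : ℤ} (hD : 1 < D)
    (hDsq : Squarefree D) {s : K} (hs : s ^ 2 = D) :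
    ∃ σ : K ≃ₐ[ℚ] K, σ s = s ∧ (∀ x, σ (σ x) = x) ∧ ∃ x, σ x ≠ x := by
  have hint : IsIntegral ℚ s := Algebra.IsIntegral.isIntegral s
  have hF : finrank ℚ (IntermediateField.adjoin ℚ {s}) = 2 := by
    rw [IntermediateField.adjoin.finrank hint]
    have hirr : Irreducible (Polynomial.X ^ 2 - Polynomial.C (D : ℚ)) :=
      X_pow_sub_C_irreducible_of_prime Nat.prime_two (sq_ne_intCast_of_squarefree hD hDsq)
    rw [← minpoly.eq_of_irreducible_of_monic hirr (by simp [hs])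
      (Polynomial.monic_X_pow_sub_C _ two_ne_zero)]
    exact Polynomial.natDegree_X_pow_sub_C
  have h2 : finrank (IntermediateField.adjoin ℚ {s}) K = 2 := by
    have := finrank_mul_finrank ℚ (IntermediateField.adjoin ℚ {s}) K
    rw [hF, hK] at this
    omega
  have : Algebra.IsQuadraticExtension (IntermediateField.adjoin ℚ {s}) K := ⟨h2⟩
  have hcard := IsGalois.card_aut_eq_finrank (IntermediateField.adjoin ℚ {s}) K
  rw [h2] at hcard
  have : Finite (Gal(K/IntermediateField.adjoin ℚ {s})) := Nat.finite_of_card_ne_zero (by omega)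
  have : Nontrivial (Gal(K/IntermediateField.adjoin ℚ {s})) :=
    (Finite.one_lt_card_iff_nontrivial).1 (by omega)
  obtain ⟨τ, hτ⟩ := exists_ne (1 : Gal(K/IntermediateField.adjoin ℚ {s}))
  refine ⟨τ.restrictScalars ℚ, ?_, fun x => ?_, ?_⟩
  · exact τ.commutes (IntermediateField.AdjoinSimple.gen ℚ s)
  · have : τ ^ 2 = 1 := by rw [← hcard]; exact pow_card_eq_one'
    exact congrArg (fun f : Gal(K/IntermediateField.adjoin ℚ {s}) => f x) ((sq τ).symm.trans this)
  · by_contra! h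
    exact hτ (AlgEquiv.ext h)

theorem isIntegral_sub_map (σ : K ≃ₐ[ℚ] K) (x : 𝓞 K) : IsIntegral ℤ ((x : K) - σ x) :=
  x.isIntegral_coe.sub (map_isIntegral_int σ x.isIntegral_coe)

variable {σ : K ≃ₐ[ℚ] K} {s y : K}

theorem linearIndependent_one_sqrt {D : ℤ} (hD : 1 < D) (hDsq : Squarefree D) (hs : s ^ 2 = D)
    {a b : ℚ} (h : (a : K) + b * s = 0) : a = 0 ∧ b = 0 := by
  have hb : b = 0 := by
    by_contra hb
    apply sq_ne_intCast_of_squarefree hD hDsq (a / b)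
    have hb' : (b : K) ≠ 0 := by exact_mod_cast hb
    have : ((a / b : ℚ) : K) ^ 2 = D := by
      push_cast
      rw [← hs, show (a : K) = -(b * s) by linear_combination h]
      field_simp
    exact_mod_cast this
  subst hb
  simpa using h

/-- Adding a relation to its image under `σ`, or subtracting, separates the `1, s` part from the `y,
s * y` part. -/
theorem linearIndependent_of_anti_invariant {D : ℤ} (hD : 1 < D) (hDsq : Squarefree D)
    (hs : s ^ 2 = D) (hσs : σ s = s) (hσy : σ y = -y) (hy : y ≠ 0) :
    LinearIndependent ℚ ![1, s, y, s * y] := by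
  rw [Fintype.linearIndependent_iff]
  intro g hg
  simp only [Fin.sum_univ_four, Algebra.smul_def, eq_ratCast] at hg
  simp only [Matrix.cons_val] at hg
  have hg' := congrArg σ hg
  simp only [map_add, map_mul, map_ratCast, hσs, hσy, map_one, map_zero] at hg'
  have h1 : (g 0 : K) + g 1 * s = 0 := by linear_combination (hg + hg') / 2
  have h2 : (g 2 : K) + g 3 * s = 0 := by
    have : ((g 2 : K) + g 3 * s) * y = 0 := by linear_combination (hg - hg') / 2
    exact (mul_eq_zero.1 this).resolve_right hy
  have h1 := linearIndependent_one_sqrt hD hDsq hs h1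
  have h2 := linearIndependent_one_sqrt hD hDsq hs h2
  intro i
  fin_cases i
  exacts [h1.1, h1.2, h2.1, h2.2]

theorem trace_eq_zero_of_anti_invariant (h : σ y = -y) : Algebra.trace ℚ K y = 0 := by
  have := Algebra.trace_eq_of_algEquiv σ y
  rw [h, map_neg] at this
  linarith

theorem trace_one_of_finrank (hK : finrank ℚ K = 4) : Algebra.trace ℚ K 1 = 4 := by
  have := Algebra.trace_algebraMap (R := ℚ) (S := K) 1
  simpa [hK] using this

theorem trace_intCast_mul (n : ℤ) (z : K) :
    Algebra.trace ℚ K (n * z) = n * Algebra.trace ℚ K z := by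
  rw [← zsmul_eq_mul, map_zsmul, zsmul_eq_mul]

/-- The discriminant of a totally real quartic field containing `√D` is bounded by the trace of
the square of any algebraic integer which is anti-invariant over `ℚ(√D)`. -/
theorem abs_discr_le_of_anti_invariant [IsTotallyReal K] (hK : finrank ℚ K = 4) {D : ℤ}
    (hD : 1 < D) (hDsq : Squarefree D) (hs : s ^ 2 = D) (hσs : σ s = s) (hyi : IsIntegral ℤ y)
    (hσy : σ y = -y) (hy : y ≠ 0) :
    |(discr K : ℚ)| ≤ 16 * D ^ 2 * Algebra.trace ℚ K (y * y) ^ 2 := by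
  have hsi : IsIntegral ℤ s := by
    refine IsIntegral.of_pow two_pos ?_
    rw [hs]
    exact isIntegral_algebraMap (x := D)
  have hfun : (fun i => ((![1, ⟨s, hsi⟩, ⟨y, hyi⟩, ⟨s * y, hsi.mul hyi⟩] : Fin 4 → 𝓞 K) i : K)) =
      ![1, s, y, s * y] := by
    ext i
    fin_cases i <;> rfl
  have h := abs_discr_le_abs_discr_of_linearIndependent hK
    ![1, ⟨s, hsi⟩, ⟨y, hyi⟩, ⟨s * y, hsi.mul hyi⟩] (by
      rw [hfun]; exact linearIndependent_of_anti_invariant hD hDsq hs hσs hσy hy)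
  rw [hfun] at h
  have ty := trace_eq_zero_of_anti_invariant hσy
  have tsy : Algebra.trace ℚ K (s * y) = 0 :=
    trace_eq_zero_of_anti_invariant (σ := σ) (by rw [map_mul, hσs, hσy, mul_neg])
  have t1 := trace_one_of_finrank hK
  have tDz (z : K) : Algebra.trace ℚ K (s * (s * z)) = D * Algebra.trace ℚ K z := by
    rw [← mul_assoc, ← sq, hs, trace_intCast_mul]
  have tss : Algebra.trace ℚ K (s * s) = D * 4 := by
    have := tDz 1
    rwa [mul_one, t1] at this
  -- As `y` and `s * y` have trace zero, the Gram matrix splits into two 2×2 blocks.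
  have hdisc : Algebra.discr ℚ ![1, s, y, s * y] =
      (16 * D - Algebra.trace ℚ K s ^ 2) *
        (D * Algebra.trace ℚ K (y * y) ^ 2 - Algebra.trace ℚ K (s * (y * y)) ^ 2) := by
    have e1 : y * (s * y) = s * (y * y) := by ring
    have e2 : s * y * (s * y) = s * (s * (y * y)) := by ring
    have e3 : s * y * s = s * (s * y) := by ring
    have e4 : s * y * y = s * (y * y) := by ring
    have e5 : y * s = s * y := by ring
    rw [Algebra.discr_def]
    simp [Matrix.det_succ_row_zero, Fin.sum_univ_succ, Algebra.traceMatrix_apply,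
      Algebra.traceForm_apply, Fin.succAbove, e1, e2, e3, e4, e5, ty, tsy, t1, tDz, tss]
    ring
  -- By Cauchy-Schwarz both block determinants are nonnegative, so the subtracted squares may be
  -- dropped.
  have c1 := trace_mul_sq_le 1 s
  rw [one_mul, one_mul, t1, tss] at c1
  have c2 := trace_mul_sq_le y (s * y)
  rw [show y * (s * y) = s * (y * y) by ring, show s * y * (s * y) = s * (s * (y * y)) by ring,
    tDz] at c2
  refine h.trans ?_
  rw [hdisc, abs_mul, abs_of_nonneg (by linarith), abs_of_nonneg (by linarith)]
  have hD0 : (0 : ℚ) < D := by exact_mod_cast (by omega : 0 < D)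
  calc _ ≤ (16 * D : ℚ) * (D * Algebra.trace ℚ K (y * y) ^ 2) :=
        mul_le_mul (sub_le_self _ (sq_nonneg _)) (sub_le_self _ (sq_nonneg _))
          (by linarith) (by linarith)
    _ = _ := by ring

/-- Parallelogram law, as `σ` preserves the trace. -/
theorem trace_sub_map_mul_self_le [IsTotallyReal K] (σ : K ≃ₐ[ℚ] K) (x : K) :
    Algebra.trace ℚ K ((x - σ x) * (x - σ x)) ≤ 4 * Algebra.trace ℚ K (x * x) := by
  have h := trace_mul_self_nonneg (x + σ x)
  have e : Algebra.trace ℚ K (σ x * σ x) = Algebra.trace ℚ K (x * x) := by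
    rw [← map_mul, Algebra.trace_eq_of_algEquiv]
  rw [show (x + σ x) * (x + σ x) = x * x + σ x * σ x + (x * σ x + x * σ x) by ring] at h
  rw [show (x - σ x) * (x - σ x) = x * x + σ x * σ x - (x * σ x + x * σ x) by ring]
  simp only [map_add, map_sub, e] at h ⊢
  linarith

/-- A sum of squares not fixed by `σ` has a summand whose root is not fixed by `σ`. -/
theorem IsSumSq.exists_not_fixed [IsTotallyReal K] (σ : K ≃ₐ[ℚ] K) {a : 𝓞 K} (ha : IsSumSq a) :
    0 ≤ Algebra.trace ℚ K (a : K) ∧ (σ (a : K) ≠ a →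
      ∃ x : 𝓞 K, σ (x : K) ≠ x ∧
        Algebra.trace ℚ K ((x : K) * x) ≤ Algebra.trace ℚ K (a : K)) := by
  induction ha with
  | zero => simp
  | sq_add x hs ih =>
    rename_i t
    obtain ⟨h0, h1⟩ := ih
    have hx := trace_mul_self_nonneg (x : K)
    simp only [map_add, map_mul] at *
    refine ⟨by linarith, fun h => ?_⟩
    by_cases hσ : σ (x : K) = x
    · obtain ⟨z, hz, hz'⟩ := h1 (fun ht => h (by rw [hσ, ht]))
      exact ⟨z, hz, by linarith⟩
    · exact ⟨x, hσ, by linarith⟩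

/-- Among the algebraic integers moved by `σ`, one has `x - σ x` of least trace norm. -/
theorem exists_minimal_trace_sub_map (σ : K ≃ₐ[ℚ] K) (hσ : ∃ x, σ x ≠ x) [IsTotallyReal K] :
    ∃ x : 𝓞 K, σ (x : K) ≠ x ∧ 1 ≤ Algebra.trace ℚ K ((x - σ x) * (x - σ x)) ∧
      ∀ z : 𝓞 K, σ (z : K) ≠ z → Algebra.trace ℚ K ((x - σ x) * (x - σ x)) ≤
        Algebra.trace ℚ K ((z - σ z) * (z - σ z)) := by
  -- These traces are natural numbers, so a least one exists.
  have key (x : 𝓞 K) : ∃ n : ℕ, (n : ℚ) = Algebra.trace ℚ K ((x - σ x) * (x - σ x)) := by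
    let y : 𝓞 K := ⟨x - σ x, isIntegral_sub_map σ x⟩
    have h : ((Algebra.trace ℤ (𝓞 K) (y * y) : ℤ) : ℚ) =
        Algebra.trace ℚ K ((x - σ x) * (x - σ x)) := Algebra.coe_trace_int (K := K) _
    have h0 : 0 ≤ Algebra.trace ℤ (𝓞 K) (y * y) := by
      have := trace_mul_self_nonneg ((x : K) - σ x)
      rw [← h] at this
      exact_mod_cast this
    exact ⟨(Algebra.trace ℤ (𝓞 K) (y * y)).toNat, by
      rw [← h]; exact_mod_cast congrArg (Int.cast : ℤ → ℚ) (Int.toNat_of_nonneg h0)⟩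
  choose f hf using key
  obtain ⟨x₀, hx₀⟩ : ∃ x : 𝓞 K, σ (x : K) ≠ x := by
    by_contra! h
    obtain ⟨x, hx⟩ := hσ
    obtain ⟨a, b, hb, rfl⟩ := IsFractionRing.div_surjective (A := 𝓞 K) x
    exact hx (by rw [map_div₀]; exact congrArg₂ _ (h a) (h b))
  obtain ⟨x, hx, hmin⟩ : ∃ x ∈ {x : 𝓞 K | σ (x : K) ≠ x},
      ∀ z ∈ {x : 𝓞 K | σ (x : K) ≠ x}, f x ≤ f z :=
    ⟨_, Function.argminOn_mem f _ ⟨x₀, hx₀⟩, fun z hz => Function.argminOn_le f _ hz⟩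
  refine ⟨x, hx, ?_, fun z hz => ?_⟩
  · have := trace_mul_self_pos (sub_ne_zero.2 (Ne.symm hx))
    rw [← hf] at this ⊢
    exact_mod_cast this
  · rw [← hf, ← hf]
    exact_mod_cast hmin z hz

end Involution

/-- The constant `C` is chosen after `D` and `ε` and before `K` and `k`.
The predicate `IsSumSq` says that an element is a sum of finitely many squares. -/
theorem corollary5p4 (D : ℤ) (hD : 1 < D) (hDsq : Squarefree D) (ε : ℝ) (hε : 0 < ε) :
    ∃ C : ℝ, 0 < C ∧
      ∀ (K : Type*) [Field K] [NumberField K] [NumberField.IsTotallyReal K],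
        Module.finrank ℚ K = 4 →
        (∃ s : K, s ^ 2 = (D : K)) →
        ∀ k : ℤ, 0 < k → (k : ℝ) < C * (NumberField.discr K : ℝ) ^ (1 / 4 - ε) →
          ∃ α ∈ totallyPositiveIntegers K,
            ¬ IsSumSq ((k : NumberField.RingOfIntegers K) * α) := by
  have hD1 : (1 : ℝ) ≤ D := by exact_mod_cast hD.le
  -- 64 = 32 · 2, from `R ≤ 32 * k` and `|Δ|^(1/4) ≤ 2 * D * R`; no dependence on `ε` is needed.
  refine ⟨1 / (64 * D), by positivity, ?_⟩
  intro K _ _ _ hK ⟨s, hs⟩ k hk hkC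
  obtain ⟨σ, hσs, hσσ, hσ⟩ := exists_algEquiv_fixing_sqrt hK hD hDsq hs
  obtain ⟨x, hx, hT1, hmin⟩ := exists_minimal_trace_sub_map σ hσ
  have hyi := isIntegral_sub_map σ x
  have hσy : σ ((x : K) - σ x) = -((x : K) - σ x) := by rw [map_sub, hσσ]; ring
  have hy : (x : K) - σ x ≠ 0 := sub_ne_zero.2 (Ne.symm hx)
  have hdisc := abs_discr_le_of_anti_invariant hK hD hDsq hs hσs hyi hσy hy
  have hbound := fun ψ : K →+* ℝ => sq_le_trace_mul_self ψ ((x : K) - σ x)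
  have htr := trace_eq_zero_of_anti_invariant hσy
  have hT1' : (1 : ℝ) ≤ (Algebra.trace ℚ K ((x - σ x) * (x - σ x)) : ℚ) := by exact_mod_cast hT1
  have hdisc' : |(discr K : ℝ)| ≤
      16 * D ^ 2 * ((Algebra.trace ℚ K ((x - σ x) * (x - σ x)) : ℚ) : ℝ) ^ 2 := by
    exact_mod_cast hdisc
  obtain ⟨y, hyx⟩ : ∃ y : 𝓞 K, (y : K) = x - σ x := ⟨⟨_, hyi⟩, rfl⟩
  obtain ⟨R, hR, hRT⟩ : ∃ R : ℝ, 1 ≤ R ∧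
      R ^ 2 = (Algebra.trace ℚ K ((x - σ x) * (x - σ x)) : ℚ) :=
    ⟨√_, Real.one_le_sqrt.2 hT1', Real.sq_sqrt (by linarith)⟩
  simp only [← hRT] at hbound hdisc'
  obtain ⟨a, haR, ha⟩ : ∃ a : ℕ, R < a ∧ (a : ℝ) ≤ R + 1 :=
    ⟨⌊R⌋₊ + 1, by exact_mod_cast Nat.lt_floor_add_one R, by
      push_cast; linarith [Nat.floor_le (by linarith : 0 ≤ R)]⟩
  refine ⟨y + (a : 𝓞 K), fun ψ => ?_, fun hsum => ?_⟩
  · have h := abs_le_of_sq_le_sq (hbound ψ) (by linarith)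
    have e : ((y + (a : 𝓞 K) : 𝓞 K) : K) = x - σ x + a := by simp [hyx]
    rw [e, map_add, map_natCast]
    linarith [neg_abs_le (ψ ((x : K) - σ x))]
  have e : (((k : 𝓞 K) * (y + (a : 𝓞 K)) : 𝓞 K) : K) =
      k * (x - σ x + (a : ℤ) * 1) := by simp [hyx]
  obtain ⟨-, h⟩ := hsum.exists_not_fixed σ
  rw [e, trace_intCast_mul, map_add (Algebra.trace ℚ K), htr, trace_intCast_mul,
    trace_one_of_finrank hK] at h
  have hk0 : (k : K) ≠ 0 := by exact_mod_cast hk.ne'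
  obtain ⟨z, hz, hz'⟩ := h (by
    rw [map_mul, map_add, hσy]
    simp only [map_intCast, map_mul, map_one]
    intro h
    have h' := add_right_cancel (mul_left_cancel₀ hk0 h)
    exact hy (self_eq_neg.1 h'.symm))
  have hle := (hmin z hz).trans (trace_sub_map_mul_self_le σ (z : K))
  have hkR : R ^ 2 ≤ 16 * k * a := by
    rw [hRT]
    have : Algebra.trace ℚ K ((x - σ x) * (x - σ x)) ≤ 16 * k * a := by
      push_cast at hz'
      linarith
    exact_mod_cast this
  have hk' : (0 : ℝ) < k := by exact_mod_cast hk
  have hkR' : R ≤ 32 * k := by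
    -- `a ≤ R + 1 ≤ 2 * R`, because `1 ≤ R`.
    have : R * R ≤ 32 * k * R := by nlinarith
    exact le_of_mul_le_mul_right this (by linarith)
  have habs : 1 ≤ |(discr K : ℝ)| := by
    exact_mod_cast Int.one_le_abs (discr_ne_zero K)
  have hpow : (discr K : ℝ) ^ (1 / 4 - ε) ≤ 2 * D * R :=
    calc (discr K : ℝ) ^ (1 / 4 - ε) ≤ |(discr K : ℝ)| ^ (1 / 4 - ε) :=
          (le_abs_self _).trans (Real.abs_rpow_le_abs_rpow _ _)
      _ ≤ |(discr K : ℝ)| ^ (1 / 4 : ℝ) :=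
          Real.rpow_le_rpow_of_exponent_le habs (by linarith)
      _ ≤ ((2 * D * R) ^ (4 : ℕ)) ^ (1 / 4 : ℝ) := by
          refine Real.rpow_le_rpow (abs_nonneg _) (hdisc'.trans ?_) (by norm_num)
          -- Weakening `D ^ 2` to `D ^ 4` makes the bound an exact fourth power.
          have : (D : ℝ) ^ 2 ≤ D ^ 4 := pow_le_pow_right₀ hD1 (by norm_num)
          calc (16 : ℝ) * D ^ 2 * (R ^ 2) ^ 2 ≤ 16 * D ^ 4 * (R ^ 2) ^ 2 := by gcongr
            _ = _ := by ring
      _ = 2 * D * R := by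
          rw [one_div]
          exact Real.pow_rpow_inv_natCast (n := 4) (by positivity) (by norm_num)
  have hfin : 1 / (64 * D) * (discr K : ℝ) ^ (1 / 4 - ε) ≤ R / 32 :=
    calc 1 / (64 * D) * (discr K : ℝ) ^ (1 / 4 - ε) ≤ 1 / (64 * D) * (2 * D * R) := by gcongr
      _ = R / 32 := by field_simp; norm_num
  linarith
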